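/- Let $X$ be a separable infinite-dimensional real Banach space. For subspaces $Y,Z\subset X$ put $$\gamma(Y,Z)=\max\Big\{\sup_{y\in Y,\ \|y\|=1}\operatorname{dist}(y,Z),\ \sup_{z\in Z,\ \|z\|=1}\operatorname{dist}(z,Y)\Big\}\qquad(\sup\emptyset=0).$$ For a finite-dimensional subspace $V\subset X$ let $\mathcal A(V)$ be the system of all Borel sets $B\subset X$ such that $V\cap(B+a)$ is Lebesgue null in $V$ for every $a\in X$. For $0<\varepsilon<1$ let $\mathcal A^*(V,\varepsilon)$ be the system of all Borel sets $B$ with $B\in\mathcal A(W)$ for every finite-dimensional subspace $W$ with $\gamma(V,W)<\varepsilon$, and let $\mathcal A^*(V)$ be the system of all sets $\bigcup_{k=1}^\infty B_k$ with $B_k\in\mathcal A^*(V,\varepsilon_k)$ for some $0<\varepsilon_k<1$. For $d\in\mathbb N=\{1,2,\dots\}$ let $\mathcal C^*_d$ be the system of all sets $\bigcup_{k=1}^\infty B_k$ with $B_k\in\mathcal A^*(V_k)$ for some subspace $V_k$ with $\dim V_k=d$. Finally let $\mathcal A$ (the Aronszajn null sets) be the system of all $B\subset X$ such that, for every sequence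 $(v_k)$ of nonzero vectors with dense linear span in $X$, one can write $B=\bigcup_{k=1}^\infty B_k$ with $B_k\in\mathcal A(\operatorname{span}\{v_k\})$. Then $\mathcal C^*_1\subset\mathcal C^*_2\subset\dots\subset\mathcal A$ and all inclusions are proper; that is, for every $d\ge 1$, $$\mathcal C^*_d\subsetneq\mathcal C^*_{d+1},\qquad \mathcal C^*_d\subsetneq\mathcal A,\qquad\text{and moreover}\qquad \bigcup_{d\ge1}\mathcal C^*_d\subsetneq\mathcal A.$$ Furthermore, for every $d\ge1$ there is a compact set $K\subset X$ with $K\in\mathcal C^*_{d+1}\setminus\mathcal C^*_d$. -/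

import Mathlib

noncomputable section

namespace NullSets

open MeasureTheory

variable {X : Type*} [NormedAddCommGroup X] [NormedSpace ℝ X]

/-- The gap `γ(Y, Z)` between two subspaces: the maximum of
`sup {dist(y, Z) : y ∈ Y, ‖y‖ = 1}` and `sup {dist(z, Y) : z ∈ Z, ‖z‖ = 1}`.
All the distances lie in `[0, 1]`, and the supremum over the empty set is `0`; hence
`γ({0}, {0}) = 0`, and `γ(Y, Z) = 1` if exactly one of `Y`, `Z` is `{0}`. -/
def gap (Y Z : Submodule ℝ X) : ℝ :=
  max (⨆ y : {y : X // y ∈ Y ∧ ‖y‖ = 1}, Metric.infDist (y : X) (Z : Set X))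
    (⨆ z : {z : X // z ∈ Z ∧ ‖z‖ = 1}, Metric.infDist (z : X) (Y : Set X))

variable [MeasurableSpace X] [BorelSpace X]

/-- `𝒜(V)`: the Borel sets `B ⊆ X` such that `V ∩ (B + a)` is Lebesgue null in the
finite-dimensional space `V` for each `a ∈ X`. -/
def classA (V : Submodule ℝ X) [FiniteDimensional ℝ V] : Set (Set X) :=
  {B | MeasurableSet B ∧
    ∀ a : X, (Measure.addHaar : Measure V) {w : V | (w : X) ∈ (fun b => b + a) '' B} = 0}

/-- `𝒜*(V, ε)`: the Borel sets belonging to `𝒜(W)` for each finite-dimensional space `W` with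
`γ(V, W) < ε`. -/
def classAStarEps (V : Submodule ℝ X) (ε : ℝ) : Set (Set X) :=
  {B | MeasurableSet B ∧
    ∀ (W : Submodule ℝ X) [FiniteDimensional ℝ W], gap V W < ε → B ∈ classA W}

/-- `𝒜*(V)`: the countable unions of sets `B k ∈ 𝒜*(V, ε k)` with `0 < ε k < 1`. -/
def classAStar (V : Submodule ℝ X) : Set (Set X) :=
  {B | ∃ (S : ℕ → Set X) (ε : ℕ → ℝ),
    (∀ k, 0 < ε k ∧ ε k < 1 ∧ S k ∈ classAStarEps V (ε k)) ∧ B = ⋃ k, S k}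

variable (X)

/-- `𝒞*_d`: the countable unions of sets `S k ∈ 𝒜*(V k)` with `dim (V k) = d`. -/
def classCStar (d : ℕ) : Set (Set X) :=
  {B | ∃ (S : ℕ → Set X) (V : ℕ → Submodule ℝ X),
    (∀ k, FiniteDimensional ℝ (V k) ∧ Module.finrank ℝ (V k) = d ∧ S k ∈ classAStar (V k)) ∧
      B = ⋃ k, S k}

/-- The Aronszajn null sets: the sets that can be written, for every sequence `v` of nonzero
vectors whose linear span is dense in `X`, as a countable union of sets
`S k ∈ 𝒜(sp {v k})`. -/
def aronszajnNull : Set (Set X) :=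
  {B | ∀ v : ℕ → X, (∀ k, v k ≠ 0) → Dense (Submodule.span ℝ (Set.range v) : Set X) →
    ∃ S : ℕ → Set X, (∀ k, S k ∈ classA (Submodule.span ℝ {v k})) ∧ B = ⋃ k, S k}

end NullSets

end

/-! Inclusions. By Fubini, `classA V` grows with `V` (`classA_mono`), and a space close to `V'`
contains a space close to any given `V ≤ V'`; this gives `classCStar_subset_succ`. If the span of
`w` is dense, a basis of `V` can be moved slightly into the span of finitely many `w k`, and Fubini
splits a set null on that span into sets null on the lines (`classA_span_image_decomp`).

Properness. The compact set is the image of the cube `[0,1]^(ℕ × d)` under `param`, a series `∑ γ k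
• (∑ l, t k l • q k l + mono (p k) t • g k)` that is affine in each block of `d` parameters, with
rapidly decreasing `γ k`.

It is not in `classCStar X d`: the derivative in block `i` is nearly `γ i • q i`, and the tuples `q
i` are dense, so for any `d`-dimensional `V` some block runs through translates of a space close to
`V`. Fubini in that block makes the preimage of a set in `classAStarEps V ε` null for the product
measure, and countably many such preimages cannot cover the cube (`image_notMem_classCStar`).

It is null on every `W` of dimension greater than `d`: the functionals `φ k` recover all coordinates
of `t` and all products across blocks as limits of affine functions on `W`, so these are affine
there. A product of two nonconstant affine functions is not affine on a non-null set, so on a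
non-null section only one block could vary, which confines the section to a `d`-dimensional plane
(`image_mem_classA`). -/

noncomputable section

namespace NullSets

open MeasureTheory Filter Topology Submodule

/-! ### Fubini arguments for sets null on translates of a subspace -/

section ClassA

variable {X : Type*} [NormedAddCommGroup X] [NormedSpace ℝ X] [MeasurableSpace X] [BorelSpace X]

lemma mem_classA_iff {V : Submodule ℝ X} [FiniteDimensional ℝ V] {B : Set X} :
    B ∈ classA V ↔ MeasurableSet B ∧
      ∀ a : X, ∀ᵐ w : V ∂Measure.addHaar, (w : X) + a ∉ B := by
  have key : ∀ a : X, {w : V | (w : X) ∈ (fun b => b + a) '' B} = {w : V | (w : X) + -a ∈ B} := by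
    intro a
    ext w
    constructor
    · rintro ⟨b, hb, h⟩
      simp only [Set.mem_ofPred_eq]
      rw [← h]
      simpa using hb
    · intro h
      exact ⟨_, h, by simp⟩
  refine and_congr_right fun _ => ⟨fun h a => ?_, fun h a => ?_⟩
  · rw [ae_iff]
    have := h (-a)
    rw [key] at this
    simpa using this
  · have := h (-a)
    rw [ae_iff] at this
    rw [key]
    simpa using this

lemma measurableSet_translate (V : Submodule ℝ X) {B : Set X} (hB : MeasurableSet B) (a : X) :
    MeasurableSet {w : V | (w : X) + a ∉ B} :=
  (hB.compl.preimage (by fun_prop : Continuous fun w : V => (w : X) + a).measurable)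

lemma classA_subset {V : Submodule ℝ X} [FiniteDimensional ℝ V] {A B : Set X}
    (hB : B ∈ classA V) (hA : MeasurableSet A) (h : A ⊆ B) : A ∈ classA V := by
  rw [mem_classA_iff] at *
  exact ⟨hA, fun a => (hB.2 a).mono fun w hw hwA => hw (h hwA)⟩

lemma classA_iUnion {ι : Type*} [Countable ι] {V : Submodule ℝ X} [FiniteDimensional ℝ V]
    {B : ι → Set X} (hB : ∀ i, B i ∈ classA V) : (⋃ i, B i) ∈ classA V := by
  simp only [mem_classA_iff] at *
  refine ⟨MeasurableSet.iUnion fun i => (hB i).1, fun a => ?_⟩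
  filter_upwards [ae_all_iff.2 fun i => (hB i).2 a] with w hw
  simpa using hw

lemma empty_mem_classA (V : Submodule ℝ X) [FiniteDimensional ℝ V] : (∅ : Set X) ∈ classA V := by
  rw [mem_classA_iff]
  simp

/-- Fubini: `W` is fibred by translates of `V`, and the set is null in each fibre. -/
lemma classA_mono {V W : Submodule ℝ X} [FiniteDimensional ℝ V] [FiniteDimensional ℝ W]
    (hVW : V ≤ W) {B : Set X} (hB : B ∈ classA V) : B ∈ classA W := by
  rw [mem_classA_iff] at *
  refine ⟨hB.1, fun a => ?_⟩
  refine ae_mem_of_ae_add_linearMap_mem (𝕜 := ℝ) (Submodule.inclusion hVW) Measure.addHaar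
    Measure.addHaar (measurableSet_translate W hB.1 a) fun y => ?_
  filter_upwards [hB.2 (y + a)] with x hx
  have : ((x : X) + (y + a)) = ((y + Submodule.inclusion hVW x : W) : X) + a := by
    simp; abel
  rw [this] at hx
  exact hx

lemma classA_ae_linearMap {E : Type*} [NormedAddCommGroup E] [NormedSpace ℝ E]
    [FiniteDimensional ℝ E] [MeasurableSpace E] [BorelSpace E] (μ : Measure E)
    [μ.IsAddHaarMeasure] {V : Submodule ℝ X} [FiniteDimensional ℝ V] {B : Set X}
    (hB : B ∈ classA V) (L : E →ₗ[ℝ] X) (hL : LinearMap.range L = V) (a : X) :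
    ∀ᵐ x ∂μ, L x + a ∉ B := by
  subst hL
  rw [mem_classA_iff] at hB
  have := (ae_comp_linearMap_mem_iff L.rangeRestrict μ Measure.addHaar L.surjective_rangeRestrict
    (measurableSet_translate _ hB.1 a)).2 (hB.2 a)
  exact this

lemma classA_bot {B : Set X} (hB : B ∈ classA (⊥ : Submodule ℝ X)) : B = ∅ := by
  rw [mem_classA_iff] at hB
  ext x
  simp only [Set.mem_empty_iff_false, iff_false]
  obtain ⟨w, hw⟩ := (hB.2 x).exists
  rwa [show (w : X) = 0 from (Submodule.mem_bot ℝ).1 w.2, zero_add] at hw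

variable [SecondCountableTopology X]

/-- The points of `B` are sorted by whether their line in direction `v` meets `B` in a null set;
Fubini on `span s × ℝ` handles those whose line does not. The vector `v` may lie in `span s`, since
the parametrization only has to be onto. -/
lemma classA_span_insert_decomp {v : X} {s : Set X} (hs : s.Finite) {B : Set X}
    (hB : haveI := FiniteDimensional.span_of_finite ℝ (hs.insert v)
      B ∈ classA (span ℝ (insert v s))) :
    have := FiniteDimensional.span_of_finite ℝ hs
    ∃ A A' : Set X, A ∈ classA (span ℝ {v}) ∧ A' ∈ classA (span ℝ s) ∧ B = A ∪ A' := by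
  have := FiniteDimensional.span_of_finite ℝ hs
  have := FiniteDimensional.span_of_finite ℝ (hs.insert v)
  have hBm : MeasurableSet B := hB.1
  have hmul : Measurable fun p : X × ℝ => p.1 + p.2 • v := by fun_prop
  set G : Set X := {x | ∀ᵐ r : ℝ, x + r • v ∉ B} with hG
  have hGm : MeasurableSet G := by
    have h1 : Measurable fun x : X => volume (Prod.mk x ⁻¹' ((fun p : X × ℝ => p.1 + p.2 • v) ⁻¹' B)) :=
      measurable_measure_prodMk_left (hmul hBm)
    have : G = (fun x : X => volume (Prod.mk x ⁻¹' ((fun p : X × ℝ => p.1 + p.2 • v) ⁻¹' B))) ⁻¹'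
        {0} := by
      ext x
      simp only [hG, Set.mem_ofPred_eq, ae_iff, not_not, Set.mem_preimage, Set.mem_singleton_iff]
      rfl
    rw [this]
    exact h1 (measurableSet_singleton 0)
  have hGinv : ∀ x ∈ G, ∀ c : ℝ, x + c • v ∈ G := by
    intro x hx c
    have := (measurePreserving_add_left (volume : Measure ℝ) c).quasiMeasurePreserving.ae hx
    filter_upwards [this] with r hr
    rwa [add_assoc, ← add_smul]
  have hrange : LinearMap.range (LinearMap.toSpanSingleton ℝ X v) = span ℝ {v} :=
    (LinearMap.span_singleton_eq_range ℝ X v).symm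
  refine ⟨B ∩ G, B \ G, ?_, ?_, (Set.inter_union_sdiff B G).symm⟩
  · rw [mem_classA_iff]
    refine ⟨hBm.inter hGm, fun a => ?_⟩
    by_cases h : a ∈ G
    · have hm := measurableSet_translate (span ℝ {v}) hBm a
      let L : ℝ →ₗ[ℝ] span ℝ {v} := (LinearMap.toSpanSingleton ℝ X v).codRestrict _ fun r => by
        simpa using Submodule.smul_mem _ r (mem_span_singleton_self v)
      have hL : Function.Surjective L := by
        rintro ⟨w, hw⟩
        obtain ⟨r, rfl⟩ := mem_span_singleton.1 hw
        exact ⟨r, by ext; simp [L]⟩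
      have := (ae_comp_linearMap_mem_iff L volume Measure.addHaar hL hm).1 (by
        filter_upwards [h] with r hr
        simpa [L, add_comm] using hr)
      filter_upwards [this] with w hw hwB
      exact hw hwB.1
    -- `G` is invariant along `v`, so a line through a point outside `G` misses `G` altogether.
    · refine Eventually.of_forall fun w hw => h ?_
      obtain ⟨r, hr⟩ := mem_span_singleton.1 w.2
      have := hGinv _ hw.2 (-r)
      rw [← hr] at this
      simpa [add_right_comm] using this
  · rw [mem_classA_iff] at hB ⊢
    refine ⟨hBm.diff hGm, fun a => ?_⟩
    let L : (span ℝ s) × ℝ →ₗ[ℝ] X :=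
      (span ℝ s).subtype.coprod (LinearMap.toSpanSingleton ℝ X v)
    have hL : LinearMap.range L = span ℝ (insert v s) := by
      rw [LinearMap.range_coprod, hrange, Submodule.range_subtype, span_insert, sup_comm]
    have := classA_ae_linearMap ((Measure.addHaar : Measure (span ℝ s)).prod (volume : Measure ℝ))
      (mem_classA_iff.2 hB) L hL a
    filter_upwards [Measure.ae_ae_of_ae_prod this] with w hw hwB
    refine hwB.2 ?_
    filter_upwards [hw] with r hr
    simpa [L, add_right_comm] using hr

lemma classA_span_image_decomp (v : ℕ → X) (n : ℕ) : ∀ {B : Set X},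
    (haveI := FiniteDimensional.span_of_finite ℝ ((Set.finite_lt_nat n).image v)
     B ∈ classA (span ℝ (v '' {i | i < n}))) →
    ∃ S : ℕ → Set X, (∀ k, S k ∈ classA (span ℝ {v k})) ∧ B = ⋃ k, S k := by
  induction n with
  | zero =>
    intro B hB
    -- Haar measure on the zero space charges its only point, so `B` is empty.
    refine ⟨fun _ => ∅, fun k => empty_mem_classA _, ?_⟩
    have hB' : B ∈ classA (⊥ : Submodule ℝ X) := by
      convert! hB
      simp
    simp [classA_bot hB']
  | succ n ih =>
    intro B hB
    have hset : v '' {i | i < n + 1} = insert (v n) (v '' {i | i < n}) := by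
      rw [← Set.image_insert_eq]
      congr 1
      ext i
      simp only [Set.mem_ofPred_eq, Set.mem_insert_iff]
      omega
    obtain ⟨A, A', hA, hA', rfl⟩ := classA_span_insert_decomp (v := v n)
      ((Set.finite_lt_nat n).image v) (B := B) (by convert! hB using 2; rw [hset])
    obtain ⟨S, hS, rfl⟩ := ih hA'
    refine ⟨fun k => S k ∪ if k = n then A else ∅, fun k => ?_, ?_⟩
    · beta_reduce
      rw [Set.union_eq_iUnion]
      refine classA_iUnion fun b => ?_
      cases b
      · by_cases hk : k = n
        · subst hk; simpa using hA
        · simpa [hk] using empty_mem_classA _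
      · exact hS k
    · rw [Set.iUnion_union_distrib]
      rw [Set.union_comm]
      congr 1
      ext x
      simp

end ClassA

/-! ### Small gap versus small perturbation of a basis -/

section Gap

variable {X : Type*} [NormedAddCommGroup X] [NormedSpace ℝ X]


lemma gap_le {V W : Submodule ℝ X} {c : ℝ} (hc : 0 ≤ c)
    (h₁ : ∀ v ∈ V, ‖v‖ = 1 → Metric.infDist v (W : Set X) ≤ c)
    (h₂ : ∀ w ∈ W, ‖w‖ = 1 → Metric.infDist w (V : Set X) ≤ c) : gap V W ≤ c :=
  max_le (Real.iSup_le (fun y => h₁ _ y.2.1 y.2.2) hc)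
    (Real.iSup_le (fun z => h₂ _ z.2.1 z.2.2) hc)

lemma exists_dist_lt_of_gap_lt {V W : Submodule ℝ X} {ε : ℝ} (h : gap V W < ε) {v : X}
    (hv : v ∈ V) (hv1 : ‖v‖ = 1) : ∃ w ∈ W, ‖v - w‖ < ε := by
  have hb : BddAbove (Set.range fun y : {y : X // y ∈ V ∧ ‖y‖ = 1} =>
      Metric.infDist (y : X) (W : Set X)) := by
    refine ⟨1, ?_⟩
    rintro _ ⟨y, rfl⟩
    calc Metric.infDist (y : X) (W : Set X) ≤ dist (y : X) 0 :=
          Metric.infDist_le_dist_of_mem W.zero_mem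
      _ = 1 := by simp [y.2.2]
  have h1 : Metric.infDist v (W : Set X) < ε :=
    ((le_ciSup hb ⟨v, hv, hv1⟩).trans (le_max_left _ _)).trans_lt h
  obtain ⟨w, hw, hlt⟩ := (Metric.infDist_lt_iff ⟨0, W.zero_mem⟩).1 h1
  exact ⟨w, hw, by rwa [← dist_eq_norm]⟩

lemma exists_close_of_gap_lt {ι : Type*} [Fintype ι] {v : ι → X} (hv : ∀ i, v i ≠ 0) {η : ℝ}
    (hη : 0 < η) : ∃ ε, 0 < ε ∧ ε < 1 ∧ ∀ W : Submodule ℝ X, gap (span ℝ (Set.range v)) W < ε →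
      ∃ u : ι → X, ∀ i, u i ∈ W ∧ ‖u i - v i‖ < η := by
  set M : ℝ := ∑ i, ‖v i‖ with hM
  have hM0 : 0 ≤ M := Finset.sum_nonneg fun i _ => norm_nonneg _
  refine ⟨min (1 / 2) (η / (M + 1)), by positivity, by
    exact (min_le_left _ _).trans_lt (by norm_num), fun W hW => ?_⟩
  have key : ∀ i, ∃ u ∈ W, ‖u - v i‖ < η := by
    intro i
    have hpos : 0 < ‖v i‖ := norm_pos_iff.2 (hv i)
    obtain ⟨w, hw, hlt⟩ := exists_dist_lt_of_gap_lt hW (v := ‖v i‖⁻¹ • v i)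
      (smul_mem _ _ (subset_span ⟨i, rfl⟩)) (by simp [norm_smul, hpos.ne'])
    refine ⟨‖v i‖ • w, W.smul_mem _ hw, ?_⟩
    have h1 : ‖v i‖ • w - v i = -(‖v i‖ • (‖v i‖⁻¹ • v i - w)) := by
      rw [smul_sub, smul_smul, mul_inv_cancel₀ hpos.ne', one_smul]; abel
    rw [h1, norm_neg, norm_smul, norm_norm]
    have h2 : ‖v i‖ ≤ M := Finset.single_le_sum (f := fun i => ‖v i‖)
      (fun i _ => norm_nonneg _) (Finset.mem_univ i)
    calc ‖v i‖ * ‖‖v i‖⁻¹ • v i - w‖ < ‖v i‖ * (η / (M + 1)) := by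
          gcongr
          exact hlt.trans_le (min_le_right _ _)
      _ ≤ (M + 1) * (η / (M + 1)) := by gcongr; linarith
      _ = η := by field_simp
  choose u hu using key
  exact ⟨u, fun i => hu i⟩

/-- By independence, coefficients are bounded by a multiple of the norm of the combination, so
replacing `v` by `u` changes any combination by a small fraction `θ` of its norm. -/
lemma exists_gap_lt_of_close {ι : Type*} [Fintype ι] {v : ι → X} (hv : LinearIndependent ℝ v)
    {ε : ℝ} (hε : 0 < ε) : ∃ η, 0 < η ∧ ∀ u : ι → X, (∀ i, ‖u i - v i‖ < η) →
      LinearIndependent ℝ u ∧ gap (span ℝ (Set.range v)) (span ℝ (Set.range u)) < ε := by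
  obtain ⟨K, hK0, hK⟩ := LinearMap.exists_antilipschitzWith (Fintype.linearCombination ℝ v)
    (LinearMap.ker_eq_bot.2 (by
      exact hv.fintypeLinearCombination_injective))
  have hbound : ∀ a : ι → ℝ, ‖a‖ ≤ K * ‖∑ i, a i • v i‖ := by
    intro a
    have := hK.le_mul_dist a 0
    simpa [dist_eq_norm, Fintype.linearCombination_apply] using this
  set N : ℝ := (Fintype.card ι : ℝ) with hN
  have hK0' : (0 : ℝ) < K := by exact_mod_cast hK0
  have hN0 : 0 ≤ N := by positivity
  set θ : ℝ := min (1 / 2) (ε / 4) with hθ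
  have hθ0 : 0 < θ := by positivity
  refine ⟨θ / ((N + 1) * K), by positivity, fun u hu => ?_⟩
  have hdiff : ∀ a : ι → ℝ, ‖∑ i, a i • v i - ∑ i, a i • u i‖ ≤ θ * ‖∑ i, a i • v i‖ := by
    intro a
    rw [← Finset.sum_sub_distrib]
    calc ‖∑ i, (a i • v i - a i • u i)‖ ≤ ∑ i, ‖a i • v i - a i • u i‖ := norm_sum_le _ _
      _ ≤ ∑ _i : ι, ‖a‖ * (θ / ((N + 1) * K)) := by
          refine Finset.sum_le_sum fun i _ => ?_
          rw [← smul_sub, norm_smul, norm_sub_rev]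
          exact mul_le_mul (norm_le_pi_norm a i) (hu i).le (norm_nonneg _) (norm_nonneg _)
      _ = N * (‖a‖ * (θ / ((N + 1) * K))) := by simp [hN]
      _ ≤ (N + 1) * ((K * ‖∑ i, a i • v i‖) * (θ / ((N + 1) * K))) := by
          gcongr
          · linarith
          · exact hbound a
      _ = θ * ‖∑ i, a i • v i‖ := by field_simp
  have hθ2 : θ ≤ 1 / 2 := min_le_left _ _
  have hθε : θ ≤ ε / 4 := min_le_right _ _
  have hcomb : ∀ (y : ι → X) (x : X), x ∈ span ℝ (Set.range y) → ∃ a : ι → ℝ, ∑ i, a i • y i = x :=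
    fun y x hx => (mem_span_range_iff_exists_fun ℝ).1 hx
  have hmem : ∀ (y : ι → X) (a : ι → ℝ), ∑ i, a i • y i ∈ span ℝ (Set.range y) :=
    fun y a => (mem_span_range_iff_exists_fun ℝ).2 ⟨a, rfl⟩
  refine ⟨?_, lt_of_le_of_lt (gap_le (c := ε / 2) (by positivity) ?_ ?_) (by linarith)⟩
  · rw [Fintype.linearIndependent_iff] at hv ⊢
    intro a ha
    refine hv a ?_
    have := hdiff a
    rw [ha, sub_zero] at this
    rw [← norm_le_zero_iff]
    nlinarith [norm_nonneg (∑ i, a i • v i)]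
  · intro x hx hx1
    obtain ⟨a, rfl⟩ := hcomb v x hx
    refine (Metric.infDist_le_dist_of_mem (hmem u a)).trans ?_
    rw [dist_eq_norm]
    refine (hdiff a).trans ?_
    rw [hx1]; linarith
  -- Since `θ ≤ 1/2`, a unit combination of `u` corresponds to a combination of `v` of norm at most
  -- `2`; hence the distance is at most `2θ ≤ ε/2`.
  · intro x hx hx1
    obtain ⟨a, rfl⟩ := hcomb u x hx
    refine (Metric.infDist_le_dist_of_mem (hmem v a)).trans ?_
    rw [dist_comm, dist_eq_norm]
    have h1 := hdiff a
    have h2 : ‖∑ i, a i • v i‖ ≤ ‖∑ i, a i • v i - ∑ i, a i • u i‖ + ‖∑ i, a i • u i‖ := by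
      simpa using norm_add_le (∑ i, a i • v i - ∑ i, a i • u i) (∑ i, a i • u i)
    rw [hx1] at h2
    nlinarith [norm_nonneg (∑ i, a i • v i)]

lemma exists_family_span_eq {V : Submodule ℝ X} [FiniteDimensional ℝ V] {d : ℕ}
    (hd : Module.finrank ℝ V = d) :
    ∃ v : Fin d → X, LinearIndependent ℝ v ∧ span ℝ (Set.range v) = V := by
  let b := Module.finBasisOfFinrankEq ℝ V hd
  refine ⟨fun i => (b i : X), b.linearIndependent.map' V.subtype (by simp), ?_⟩
  have : (Set.range fun i => (b i : X)) = V.subtype '' Set.range b := by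
    rw [← Set.range_comp]; rfl
  rw [this, span_image, b.span_eq, Submodule.map_top, range_subtype]

lemma exists_linearIndependent_fin (hX : ¬ FiniteDimensional ℝ X) (n : ℕ) :
    ∃ v : Fin n → X, LinearIndependent ℝ v := by
  refine (exists_linearIndependent_of_le_rank (R := ℝ) (M := X) (n := n) ?_)
  have : Cardinal.aleph0 ≤ Module.rank ℝ X := by
    rw [← not_lt]
    exact fun h => hX (Module.rank_lt_aleph0_iff.1 h)
  exact (Cardinal.natCast_le_aleph0).trans this

lemma exists_finrank_succ_ge (hX : ¬ FiniteDimensional ℝ X) {V : Submodule ℝ X}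
    [FiniteDimensional ℝ V] :
    ∃ V' : Submodule ℝ X, ∃ _ : FiniteDimensional ℝ V',
      V ≤ V' ∧ Module.finrank ℝ V' = Module.finrank ℝ V + 1 := by
  obtain ⟨v, hv, hspan⟩ := exists_family_span_eq (V := V) rfl
  have : ∃ x, x ∉ V := by
    by_contra! h
    have : V = ⊤ := by ext; simp [h]
    subst this
    exact hX (Module.finite_def.2 (Module.Finite.iff_fg.1 ‹_›))
  obtain ⟨x, hx⟩ := this
  have hli : LinearIndependent ℝ (Fin.cons x v : Fin (Module.finrank ℝ V + 1) → X) :=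
    linearIndependent_finCons.2 ⟨hv, by rwa [hspan]⟩
  refine ⟨span ℝ (Set.range (Fin.cons x v : Fin (Module.finrank ℝ V + 1) → X)),
    FiniteDimensional.span_of_finite ℝ (Set.finite_range _), ?_, ?_⟩
  · conv_lhs => rw [← hspan]
    refine span_mono ?_
    rw [Fin.range_cons]
    exact Set.subset_insert _ _
  · simpa using finrank_span_eq_card hli

lemma le_finrank_of_gap_lt {V : Submodule ℝ X} [FiniteDimensional ℝ V] :
    ∃ ε, 0 < ε ∧ ε < 1 ∧ ∀ (W : Submodule ℝ X) [FiniteDimensional ℝ W], gap V W < ε →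
      Module.finrank ℝ V ≤ Module.finrank ℝ W := by
  obtain ⟨v, hv, hspan⟩ := exists_family_span_eq (V := V) rfl
  obtain ⟨η, hη, hη'⟩ := exists_gap_lt_of_close hv one_pos
  obtain ⟨ε, hε, hε1, h⟩ := exists_close_of_gap_lt (fun i => hv.ne_zero i) hη
  refine ⟨ε, hε, hε1, fun W _ hW => ?_⟩
  rw [hspan] at h
  obtain ⟨u, hu⟩ := h W hW
  have hli := (hη' u fun i => (hu i).2).1
  have : LinearIndependent ℝ fun i => (⟨u i, (hu i).1⟩ : W) :=
    LinearIndependent.of_comp W.subtype hli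
  simpa using this.fintype_card_le_finrank

end Gap

/-! ### The chain of inclusions up to the Aronszajn null sets -/

section ClassC

variable {X : Type*} [NormedAddCommGroup X] [NormedSpace ℝ X] [MeasurableSpace X] [BorelSpace X]

lemma mem_classCStar_iff {d : ℕ} {B : Set X} :
    B ∈ classCStar X d ↔ ∃ (S : ℕ → Set X) (V : ℕ → Submodule ℝ X) (ε : ℕ → ℝ),
      (∀ k, FiniteDimensional ℝ (V k) ∧ Module.finrank ℝ (V k) = d ∧ 0 < ε k ∧ ε k < 1 ∧
        S k ∈ classAStarEps (V k) (ε k)) ∧ B = ⋃ k, S k := by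
  constructor
  · rintro ⟨S, V, h, rfl⟩
    choose hfd hdim T ε hT hS using h
    refine ⟨fun k => T k.unpair.1 k.unpair.2, fun k => V k.unpair.1,
      fun k => ε k.unpair.1 k.unpair.2, fun k => ⟨hfd _, hdim _, hT _ _⟩, ?_⟩
    rw [Set.iUnion_unpair fun i j => T i j]
    exact Set.iUnion_congr hS
  · rintro ⟨S, V, ε, h, rfl⟩
    exact ⟨S, V, fun k => ⟨(h k).1, (h k).2.1, fun _ => S k, fun _ => ε k,
      fun _ => (h k).2.2, (Set.iUnion_const _).symm⟩, rfl⟩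

lemma classCStar_subset {d : ℕ} {A B : Set X} (hB : B ∈ classCStar X d) (hA : MeasurableSet A)
    (hAB : A ⊆ B) : A ∈ classCStar X d := by
  obtain ⟨S, V, ε, h, rfl⟩ := mem_classCStar_iff.1 hB
  refine mem_classCStar_iff.2 ⟨fun k => S k ∩ A, V, ε, fun k => ?_, ?_⟩
  · obtain ⟨h1, h2, h3, h4, h5⟩ := h k
    have hm := h5.1.inter hA
    exact ⟨h1, h2, h3, h4, hm,
      fun W _ hW => classA_subset (h5.2 W hW) hm Set.inter_subset_left⟩
  · rw [← Set.iUnion_inter, Set.inter_eq_right.2 hAB]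

lemma exists_classAStarEps_of_le {V V' : Submodule ℝ X} [FiniteDimensional ℝ V]
    [FiniteDimensional ℝ V'] (hVV' : V ≤ V') {B : Set X} {ε : ℝ} (hε : 0 < ε)
    (hB : B ∈ classAStarEps V ε) : ∃ ε', 0 < ε' ∧ ε' < 1 ∧ B ∈ classAStarEps V' ε' := by
  obtain ⟨v', hv', hspan'⟩ := exists_family_span_eq (V := V') rfl
  obtain ⟨v, hv, hspan⟩ := exists_family_span_eq (V := V) rfl
  obtain ⟨η, hη, hη'⟩ := exists_gap_lt_of_close hv hε
  have hle : ∀ i, v i ∈ V' := fun i => hVV' (hspan ▸ subset_span ⟨i, rfl⟩)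
  have hne : ∀ i, v i ≠ 0 := fun i => hv.ne_zero i
  have key : ∃ ε', 0 < ε' ∧ ε' < 1 ∧ ∀ W : Submodule ℝ X, gap V' W < ε' →
      ∃ u : Fin (Module.finrank ℝ V) → X, ∀ i, u i ∈ W ∧ ‖u i - v i‖ < η := by
    -- A redundant family spanning `V'` and containing a basis of `V`: independence is not needed
    -- for this direction.
    obtain ⟨ε', h0, h1, h⟩ := exists_close_of_gap_lt
      (v := Sum.elim v v') (by rintro (i | i); exacts [hne i, hv'.ne_zero i]) hη
    have hs : span ℝ (Set.range (Sum.elim v v')) = V' := by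
      rw [Set.Sum.elim_range, span_union, hspan, hspan', sup_eq_right.2 hVV']
    rw [hs] at h
    refine ⟨ε', h0, h1, fun W hW => ?_⟩
    obtain ⟨u, hu⟩ := h W hW
    exact ⟨fun i => u (Sum.inl i), fun i => hu (Sum.inl i)⟩
  obtain ⟨ε', h0, h1, h⟩ := key
  refine ⟨ε', h0, h1, hB.1, fun W _ hW => ?_⟩
  obtain ⟨u, hu⟩ := h W hW
  have := FiniteDimensional.span_of_finite ℝ (Set.finite_range u)
  have hgap := (hη' u fun i => (hu i).2).2
  rw [hspan] at hgap
  refine classA_mono ?_ (hB.2 (span ℝ (Set.range u)) hgap)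
  rw [span_le]
  rintro _ ⟨i, rfl⟩
  exact (hu i).1

lemma classCStar_subset_succ (hX : ¬ FiniteDimensional ℝ X) (d : ℕ) :
    classCStar X d ⊆ classCStar X (d + 1) := by
  intro B hB
  obtain ⟨S, V, ε, h, rfl⟩ := mem_classCStar_iff.1 hB
  have : ∀ k, ∃ (V' : Submodule ℝ X) (ε' : ℝ), FiniteDimensional ℝ V' ∧
      Module.finrank ℝ V' = d + 1 ∧ 0 < ε' ∧ ε' < 1 ∧ S k ∈ classAStarEps V' ε' := by
    intro k
    obtain ⟨h1, h2, h3, -, h5⟩ := h k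
    obtain ⟨V', hfd, hle, hdim⟩ := exists_finrank_succ_ge hX (V := V k)
    obtain ⟨ε', h0, h1, h⟩ := exists_classAStarEps_of_le hle h3 h5
    exact ⟨V', ε', hfd, by rw [hdim, h2], h0, h1, h⟩
  choose V' ε' h' using this
  exact mem_classCStar_iff.2 ⟨S, V', ε', h', rfl⟩

lemma aronszajnNull_iUnion {ι : Type*} [Countable ι] {B : ι → Set X}
    (hB : ∀ n, B n ∈ aronszajnNull X) : (⋃ n, B n) ∈ aronszajnNull X := by
  intro v hv hd
  choose S hS hBS using fun n => hB n v hv hd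
  refine ⟨fun k => ⋃ n, S n k, fun k => classA_iUnion fun n => hS n k, ?_⟩
  rw [Set.iUnion_comm]
  exact Set.iUnion_congr hBS

lemma classAStarEps_subset_aronszajnNull [SecondCountableTopology X] {V : Submodule ℝ X}
    [FiniteDimensional ℝ V] {ε : ℝ} (hε : 0 < ε) : classAStarEps V ε ⊆ aronszajnNull X := by
  intro B hB w _ hd
  obtain ⟨v, hv, hspan⟩ := exists_family_span_eq (V := V) rfl
  obtain ⟨η, hη, hη'⟩ := exists_gap_lt_of_close hv hε
  have : ∀ i, ∃ u ∈ span ℝ (Set.range w), ‖u - v i‖ < η := by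
    intro i
    obtain ⟨u, hu, h⟩ := Metric.dense_iff.1 hd (v i) η hη
    exact ⟨u, h, by rwa [← dist_eq_norm]⟩
  choose u hu hclose using this
  have hmono : Monotone fun n : ℕ => span ℝ (w '' {i | i < n}) := fun m n hmn =>
    span_mono (Set.image_mono fun i hi => lt_of_lt_of_le hi hmn)
  have hn : ∀ i, ∃ n : ℕ, u i ∈ span ℝ (w '' {i | i < n}) := by
    intro i
    have h1 : Set.range w = ⋃ n : ℕ, w '' {i | i < n} := by
      rw [← Set.image_iUnion, ← Set.image_univ]
      congr 1
      ext j
      simpa using ⟨j + 1, Nat.lt_succ_self j⟩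
    have h2 := hu i
    rw [h1, span_iUnion, mem_iSup_of_directed _ hmono.directed_le] at h2
    exact h2
  choose n hn using hn
  set N := Finset.univ.sup n
  have := FiniteDimensional.span_of_finite ℝ ((Set.finite_lt_nat N).image w)
  have := FiniteDimensional.span_of_finite ℝ (Set.finite_range u)
  have hgap := (hη' u hclose).2
  rw [hspan] at hgap
  refine classA_span_image_decomp w N (classA_mono ?_ (hB.2 (span ℝ (Set.range u)) hgap))
  rw [span_le]
  rintro _ ⟨i, rfl⟩
  exact hmono (Finset.le_sup (Finset.mem_univ i)) (hn i)

lemma classCStar_subset_aronszajnNull [SecondCountableTopology X] (d : ℕ) :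
    classCStar X d ⊆ aronszajnNull X := by
  intro B hB
  obtain ⟨S, V, ε, h, rfl⟩ := mem_classCStar_iff.1 hB
  refine aronszajnNull_iUnion fun k => ?_
  obtain ⟨h1, -, h3, -, h5⟩ := h k
  exact classAStarEps_subset_aronszajnNull h3 h5

end ClassC

/-! ### The block-affine parametrization of the compact set -/

section Construction

lemma exists_seq_of_forall_lt_exists {α : Type*} (R : ∀ n : ℕ, (∀ m, m < n → α) → α → Prop)
    (h : ∀ n f, ∃ y, R n f y) : ∃ g : ℕ → α, ∀ n, R n (fun m _ => g m) (g n) := by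
  choose c hc using h
  refine ⟨fun n => Nat.strongRec (motive := fun _ => α) (fun n f => c n f) n, fun n => ?_⟩
  beta_reduce
  conv => arg 3; rw [Nat.strongRec_eq]
  exact hc _ _

/-- A coordinate of `t`, or the product of two coordinates of `t` from different blocks. -/
def mono {d : ℕ} (ab : (ℕ × Fin d) × (ℕ × Fin d)) (t : ℕ → Fin d → ℝ) : ℝ :=
  if ab.1.1 = ab.2.1 then t ab.1.1 ab.1.2 else t ab.1.1 ab.1.2 * t ab.2.1 ab.2.2

/-- The cube of all parameters with values in `[0, 1]`. -/
def cube (d : ℕ) : Set (ℕ → Fin d → ℝ) := Set.pi Set.univ fun _ => Set.Icc 0 1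

/-- The vectors, functionals and coefficients from which a block-affine map on the cube is
built. -/
structure BlockData (X : Type*) [NormedAddCommGroup X] [NormedSpace ℝ X] (d : ℕ) where
  q : ℕ → Fin d → X
  p : ℕ → (ℕ × Fin d) × (ℕ × Fin d)
  g : ℕ → X
  φ : ℕ → X →L[ℝ] ℝ
  γ : ℕ → ℝ
  p_le : ∀ k, (p k).1.1 ≤ k ∧ (p k).2.1 ≤ k
  p_freq : ∀ ab N, ∃ k, N ≤ k ∧ p k = ab
  q_dense : ∀ (v : Fin d → X) (η : ℝ), 0 < η → ∀ N, ∃ k, N ≤ k ∧ ∀ l, ‖q k l - v l‖ < η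
  φ_g_self : ∀ k, φ k (g k) = 1
  φ_g : ∀ k i, i < k → φ k (g i) = 0
  φ_q : ∀ k i l, i ≤ k → φ k (q i l) = 0
  g_norm : ∀ k, ‖g k‖ ≤ (1 / 2) ^ k
  γ_pos : ∀ k, 0 < γ k
  γ_le : ∀ i k, i < k →
    γ k * (∑ l, ‖q k l‖ + ‖g k‖) * (‖φ i‖ + 1) ≤ γ i * ((1 / 2) ^ i * (1 / 2) ^ k)

variable {d : ℕ}

lemma mono_mem {ab : (ℕ × Fin d) × (ℕ × Fin d)} {t : ℕ → Fin d → ℝ} (ht : t ∈ cube d) :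
    mono ab t ∈ Set.Icc (0 : ℝ) 1 := by
  have h : ∀ k l, 0 ≤ t k l ∧ t k l ≤ 1 := fun k l =>
    ⟨(ht k trivial).1 l, (ht k trivial).2 l⟩
  unfold mono
  split_ifs
  · exact h _ _
  · exact ⟨mul_nonneg (h _ _).1 (h _ _).1, mul_le_one₀ (h _ _).2 (h _ _).1 (h _ _).2⟩

lemma continuous_mono (ab : (ℕ × Fin d) × (ℕ × Fin d)) : Continuous (mono ab) := by
  unfold mono
  split_ifs <;> fun_prop

lemma update_mem_cube {t : ℕ → Fin d → ℝ} (ht : t ∈ cube d) (i : ℕ) {s : Fin d → ℝ}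
    (hs : s ∈ Set.Icc (0 : Fin d → ℝ) 1) : Function.update t i s ∈ cube d := by
  intro k _
  by_cases h : k = i
  · subst h; simpa using hs
  · simpa [h] using ht k trivial

lemma isCompact_cube : IsCompact (cube d) := isCompact_univ_pi fun _ => isCompact_Icc

lemma single_mem_Icc (l : Fin d) : (Pi.single l 1 : Fin d → ℝ) ∈ Set.Icc (0 : Fin d → ℝ) 1 :=
  ⟨fun j => by by_cases h : j = l <;> simp [h],
    fun j => by by_cases h : j = l <;> simp [h]⟩

/-- The two factors of a product lie in different blocks, so the function is affine in each block
and determined by its values at the vertices `0` and `e_l`. -/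
lemma mono_update (ab : (ℕ × Fin d) × (ℕ × Fin d)) (t : ℕ → Fin d → ℝ) (i : ℕ)
    (s : Fin d → ℝ) : mono ab (Function.update t i s) = mono ab (Function.update t i 0) +
      ∑ l, s l * (mono ab (Function.update t i (Pi.single l 1)) -
        mono ab (Function.update t i 0)) := by
  obtain ⟨⟨a, j⟩, ⟨b, j'⟩⟩ := ab
  simp only [mono]
  by_cases hab : a = b
  · by_cases ha : a = i
    · simp [hab, ← ha, Pi.single_apply]
    · simp [hab, hab ▸ ha]
  · by_cases ha : a = i
    · have hb : b ≠ i := fun hb => hab (ha.trans hb.symm)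
      subst ha
      simp [hab, hb, Pi.single_apply]
    · by_cases hb : b = i
      · subst hb
        simp [ha, Pi.single_apply, mul_comm]
      · simp [ha, hb]

namespace BlockData

variable {X : Type*} [NormedAddCommGroup X] [NormedSpace ℝ X] (D : BlockData X d)

/-- The `k`-th summand of the parametrization, without its coefficient. -/
def term (k : ℕ) (t : ℕ → Fin d → ℝ) : X := ∑ l, t k l • D.q k l + mono (D.p k) t • D.g k

/-- The parametrization, affine in each block of parameters. -/
def param (t : ℕ → Fin d → ℝ) : X := ∑' k, D.γ k • D.term k t

/-- A bound of the `k`-th summand. -/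
def bd (k : ℕ) : ℝ := ∑ l, ‖D.q k l‖ + ‖D.g k‖

lemma bd_nonneg (k : ℕ) : 0 ≤ D.bd k := by unfold bd; positivity

lemma norm_term_le (k : ℕ) {t : ℕ → Fin d → ℝ} (ht : t ∈ cube d) : ‖D.term k t‖ ≤ D.bd k := by
  unfold term bd
  refine (norm_add_le _ _).trans (add_le_add ((norm_sum_le _ _).trans
    (Finset.sum_le_sum fun l _ => ?_)) ?_)
  · rw [norm_smul, Real.norm_eq_abs, abs_of_nonneg ((ht k trivial).1 l)]
    exact mul_le_of_le_one_left (norm_nonneg _) ((ht k trivial).2 l)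
  · rw [norm_smul, Real.norm_eq_abs, abs_of_nonneg (mono_mem ht).1]
    exact mul_le_of_le_one_left (norm_nonneg _) (mono_mem ht).2

lemma γ_mul_bd_le {i k : ℕ} (h : i < k) :
    D.γ k * D.bd k ≤ D.γ i * ((1 / 2) ^ i * (1 / 2) ^ k) :=
  (le_mul_of_one_le_right (mul_nonneg (D.γ_pos k).le (D.bd_nonneg k))
    (by linarith [norm_nonneg (D.φ i)])).trans (D.γ_le i k h)

lemma γ_mul_bd_mul_norm_le {i k : ℕ} (h : i < k) :
    D.γ k * D.bd k * ‖D.φ i‖ ≤ D.γ i * ((1 / 2) ^ i * (1 / 2) ^ k) :=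
  (mul_le_mul_of_nonneg_left (by linarith)
    (mul_nonneg (D.γ_pos k).le (D.bd_nonneg k))).trans (D.γ_le i k h)

lemma summable_bd : Summable fun k => D.γ k * D.bd k := by
  refine Summable.of_nonneg_of_le (fun k => mul_nonneg (D.γ_pos k).le (D.bd_nonneg k)) (fun k => ?_)
    (summable_geometric_two.mul_left (D.γ 0 * D.bd 0 + D.γ 0))
  -- `γ_le` compares `k` only with smaller indices, so the term `k = 0` is put into the constant by
  -- hand.
  rcases Nat.eq_zero_or_pos k with rfl | hk
  · simpa using (D.γ_pos 0).le
  · have := D.γ_mul_bd_le hk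
    have h2 : 0 ≤ D.γ 0 * D.bd 0 * (1 / 2) ^ k :=
      mul_nonneg (mul_nonneg (D.γ_pos 0).le (D.bd_nonneg 0)) (by positivity)
    rw [add_mul]
    simp only [pow_zero, one_mul] at this
    linarith

lemma norm_smul_term_le (k : ℕ) {t : ℕ → Fin d → ℝ} (ht : t ∈ cube d) :
    ‖D.γ k • D.term k t‖ ≤ D.γ k * D.bd k := by
  rw [norm_smul, Real.norm_eq_abs, abs_of_pos (D.γ_pos k)]
  exact mul_le_mul_of_nonneg_left (D.norm_term_le k ht) (D.γ_pos k).le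

lemma term_update (k : ℕ) (t : ℕ → Fin d → ℝ) (i : ℕ) (s : Fin d → ℝ) :
    D.term k (Function.update t i s) = D.term k (Function.update t i 0) +
      ∑ l, s l • (D.term k (Function.update t i (Pi.single l 1)) -
        D.term k (Function.update t i 0)) := by
  unfold term
  rw [mono_update, add_smul, Finset.sum_smul]
  by_cases hk : k = i
  · subst hk
    simp [Pi.single_apply, smul_add, Finset.sum_add_distrib, sub_smul, smul_sub, mul_sub,
      mul_smul, ite_smul]
    abel
  · simp [hk, smul_sub, sub_smul, mul_sub, mul_smul]
    abel

variable [CompleteSpace X]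

lemma hasSum_param {t : ℕ → Fin d → ℝ} (ht : t ∈ cube d) :
    HasSum (fun k => D.γ k • D.term k t) (D.param t) :=
  (Summable.of_norm_bounded D.summable_bd fun k => D.norm_smul_term_le k ht).hasSum

lemma continuousOn_param : ContinuousOn D.param (cube d) := by
  refine continuousOn_tsum (fun k => ?_) D.summable_bd fun k t ht => D.norm_smul_term_le k ht
  refine Continuous.continuousOn ?_
  unfold term
  have := continuous_mono (D.p k)
  fun_prop

/-- `φ i` kills the terms before `i`, reads off `mono (p i)` in the term `i`, and sees a tail made
small by `γ_le`. -/
lemma abs_φ_param_sub_le (i : ℕ) {t : ℕ → Fin d → ℝ} (ht : t ∈ cube d) :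
    |D.φ i (D.param t) - D.γ i * mono (D.p i) t| ≤ D.γ i * (1 / 2) ^ i * 2 := by
  have h1 : HasSum (fun k => D.φ i (D.γ k • D.term k t)) (D.φ i (D.param t)) :=
    (D.φ i).hasSum (D.hasSum_param ht)
  have h2 : HasSum (fun k => if k = i then D.γ i * mono (D.p i) t else 0)
      (D.γ i * mono (D.p i) t) := hasSum_ite_eq i _
  rw [← (h1.sub h2).tsum_eq, ← Real.norm_eq_abs]
  refine tsum_of_norm_bounded (hasSum_geometric_two.mul_left _) fun k => ?_
  have hr : 0 ≤ D.γ i * (1 / 2) ^ i * (1 / 2) ^ k := mul_nonneg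
    (mul_nonneg (D.γ_pos i).le (by positivity)) (by positivity)
  rcases lt_trichotomy k i with hk | rfl | hk
  · have : D.φ i (D.term k t) = 0 := by
      simp [term, D.φ_g i k hk, D.φ_q i k _ hk.le]
    simpa [this, hk.ne] using hr
  · have : D.φ k (D.term k t) = mono (D.p k) t := by
      simp [term, D.φ_g_self k, D.φ_q k k _ le_rfl]
    simpa [this] using hr
  · rw [if_neg hk.ne', sub_zero]
    calc ‖D.φ i (D.γ k • D.term k t)‖ ≤ ‖D.φ i‖ * ‖D.γ k • D.term k t‖ := (D.φ i).le_opNorm _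
      _ ≤ ‖D.φ i‖ * (D.γ k * D.bd k) := by gcongr; exact D.norm_smul_term_le k ht
      _ = D.γ k * D.bd k * ‖D.φ i‖ := mul_comm _ _
      _ ≤ D.γ i * ((1 / 2) ^ i * (1 / 2) ^ k) := D.γ_mul_bd_mul_norm_le hk
      _ = D.γ i * (1 / 2) ^ i * (1 / 2) ^ k := by ring

/-- The derivative of the parametrization in the `l`-th coordinate of the `i`-th block. -/
def dir (t : ℕ → Fin d → ℝ) (i : ℕ) (l : Fin d) : X :=
  D.param (Function.update t i (Pi.single l 1)) - D.param (Function.update t i 0)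

lemma param_update {t : ℕ → Fin d → ℝ} (ht : t ∈ cube d) (i : ℕ) {s : Fin d → ℝ}
    (hs : s ∈ Set.Icc (0 : Fin d → ℝ) 1) :
    D.param (Function.update t i s) =
      D.param (Function.update t i 0) + ∑ l, s l • D.dir t i l := by
  have h0 := D.hasSum_param (update_mem_cube ht i (s := 0) ⟨le_rfl, zero_le_one⟩)
  have h1 := fun l => D.hasSum_param (update_mem_cube ht i (single_mem_Icc l))
  have h2 := h0.add (hasSum_sum fun l (_ : l ∈ Finset.univ) => ((h1 l).sub h0).const_smul (s l))
  refine (D.hasSum_param (update_mem_cube ht i hs)).unique (h2.congr_fun ?_)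
  intro k
  rw [term_update, smul_add, Finset.smul_sum]
  simp only [← smul_sub, smul_comm (D.γ k)]

/-- Terms before `i` do not involve block `i`, by `p_le`. Two tails contribute `4` units of `γ i *
(1/2)^i`, and the vector `g i` contributes one more. -/
lemma norm_dir_sub_le {t : ℕ → Fin d → ℝ} (ht : t ∈ cube d) (i : ℕ) (l : Fin d) :
    ‖D.dir t i l - D.γ i • D.q i l‖ ≤ D.γ i * (1 / 2) ^ i * 5 := by
  have hz : (0 : Fin d → ℝ) ∈ Set.Icc (0 : Fin d → ℝ) 1 := ⟨le_rfl, zero_le_one⟩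
  have ht0 := update_mem_cube ht i hz
  have ht1 := update_mem_cube ht i (single_mem_Icc l)
  set m : ℝ := mono (D.p i) (Function.update t i (Pi.single l 1)) -
    mono (D.p i) (Function.update t i 0) with hm
  have hm1 : |m| ≤ 1 := by
    have h1 := mono_mem (ab := D.p i) ht0
    have h2 := mono_mem (ab := D.p i) ht1
    rw [abs_le]
    constructor <;> linarith [h1.1, h1.2, h2.1, h2.2]
  have h2 : HasSum (fun k => if k = i then D.γ i • (D.q i l + m • D.g i) else 0)
      (D.γ i • (D.q i l + m • D.g i)) := hasSum_ite_eq i _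
  have h1 := ((D.hasSum_param ht1).sub (D.hasSum_param ht0)).sub h2
  have hγ := D.γ_pos i
  have hg := D.g_norm i
  have key : ‖D.dir t i l - D.γ i • (D.q i l + m • D.g i)‖ ≤ D.γ i * (1 / 2) ^ i * 2 * 2 := by
    unfold dir
    rw [← h1.tsum_eq]
    refine tsum_of_norm_bounded (hasSum_geometric_two.mul_left _) fun k => ?_
    have hr : 0 ≤ D.γ i * (1 / 2) ^ i * 2 * (1 / 2) ^ k := by positivity
    rcases lt_trichotomy k i with hk | rfl | hk
    · have : D.term k (Function.update t i (Pi.single l 1)) =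
          D.term k (Function.update t i 0) := by
        have hp := D.p_le k
        have e1 : (D.p k).1.1 ≠ i := by omega
        have e2 : (D.p k).2.1 ≠ i := by omega
        simp [term, mono, e1, e2, hk.ne]
      simpa [this, hk.ne] using hr
    · have : D.term k (Function.update t k (Pi.single l 1)) -
          D.term k (Function.update t k 0) = D.q k l + m • D.g k := by
        simp [term, hm, sub_smul, Pi.single_apply, ite_smul]
        abel
      rw [if_pos rfl, ← smul_sub, this, sub_self, norm_zero]
      exact hr
    · rw [if_neg hk.ne', sub_zero]
      refine (norm_sub_le _ _).trans ((add_le_add (D.norm_smul_term_le k ht1)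
        (D.norm_smul_term_le k ht0)).trans ?_)
      have := D.γ_mul_bd_le hk
      linarith
  have h3 : D.dir t i l - D.γ i • D.q i l =
      (D.dir t i l - D.γ i • (D.q i l + m • D.g i)) + D.γ i • (m • D.g i) := by
    rw [smul_add]; abel
  rw [h3]
  refine (norm_add_le _ _).trans ?_
  have h4 : ‖D.γ i • (m • D.g i)‖ ≤ D.γ i * (1 / 2) ^ i := by
    rw [norm_smul, norm_smul, Real.norm_eq_abs, Real.norm_eq_abs, abs_of_pos hγ]
    gcongr
    calc |m| * ‖D.g i‖ ≤ 1 * (1 / 2) ^ i := by gcongr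
      _ = (1 / 2) ^ i := one_mul _
  linarith

end BlockData
end Construction

/-! ### Existence of the data, by recursion -/

section Existence

variable {X : Type*} [NormedAddCommGroup X] [NormedSpace ℝ X]

lemma exists_dual_eq_one_of_notMem {U : Submodule ℝ X} [FiniteDimensional ℝ U] {x : X}
    (hx : x ∉ U) : ∃ f : X →L[ℝ] ℝ, f x = 1 ∧ ∀ y ∈ U, f y = 0 := by
  have : IsClosed (U : Set X) := U.closed_of_finiteDimensional
  obtain ⟨f, hf⟩ := SeparatingDual.exists_eq_one (R := ℝ) (V := X ⧸ U) (x := U.mkQ x) (by simpa)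
  exact ⟨f.comp U.mkQL, by simpa using hf, fun y hy => by
    have : U.mkQ y = 0 := by simpa
    simpa using congrArg f this⟩

lemma exists_small_notMem (hX : ¬ FiniteDimensional ℝ X) (U : Submodule ℝ X)
    [FiniteDimensional ℝ U] {r : ℝ} (hr : 0 < r) : ∃ x, x ∉ U ∧ ‖x‖ ≤ r := by
  have : ∃ x, x ∉ U := by
    by_contra! h
    have : U = ⊤ := by ext; simp [h]
    subst this
    exact hX (Module.finite_def.2 (Module.Finite.iff_fg.1 ‹_›))
  obtain ⟨x, hx⟩ := this
  have hx0 : x ≠ 0 := fun h => hx (h ▸ U.zero_mem)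
  have hn : 0 < ‖x‖ := norm_pos_iff.2 hx0
  refine ⟨(r / ‖x‖) • x, fun h => hx ((U.smul_mem_iff (by positivity)).1 h), ?_⟩
  rw [norm_smul, Real.norm_eq_abs, abs_of_pos (by positivity), div_mul_cancel₀ _ hn.ne']

lemma exists_frequent_enumeration {ι : Type*} [Countable ι] (r : ι → ℕ) {i₀ : ι}
    (hi₀ : r i₀ = 0) : ∃ p : ℕ → ι, (∀ k, r (p k) ≤ k) ∧ ∀ i N, ∃ k, N ≤ k ∧ p k = i := by
  classical
  have : Nonempty ι := ⟨i₀⟩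
  obtain ⟨e, he⟩ := exists_surjective_nat ι
  refine ⟨fun k => if r (e k.unpair.1) ≤ k then e k.unpair.1 else i₀, fun k => ?_,
    fun i N => ?_⟩
  · dsimp only
    split_ifs with h
    · exact h
    · simp [hi₀]
  · obtain ⟨n, rfl⟩ := he i
    have h := Nat.right_le_pair n (N + r (e n))
    refine ⟨Nat.pair n (N + r (e n)), by omega, ?_⟩
    simp only [Nat.unpair_pair]
    rw [if_pos (by omega)]

lemma exists_blockData [TopologicalSpace.SeparableSpace X] (hX : ¬ FiniteDimensional ℝ X) {d : ℕ}
    (hd : 1 ≤ d) : Nonempty (BlockData X d) := by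
  obtain ⟨p, hp, hpf⟩ := exists_frequent_enumeration
    (fun ab : (ℕ × Fin d) × (ℕ × Fin d) => max ab.1.1 ab.2.1)
    (i₀ := ((0, ⟨0, hd⟩), (0, ⟨0, hd⟩))) (by simp)
  -- Unpairing makes each member of the dense sequence recur at arbitrarily large indices.
  let q : ℕ → Fin d → X := fun k => TopologicalSpace.denseSeq (Fin d → X) k.unpair.1
  have hq : ∀ (v : Fin d → X) (η : ℝ), 0 < η → ∀ N, ∃ k, N ≤ k ∧ ∀ l, ‖q k l - v l‖ < η := by
    intro v η hη N
    obtain ⟨n, hn⟩ := (TopologicalSpace.denseRange_denseSeq (Fin d → X)).exists_dist_lt v hη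
    refine ⟨Nat.pair n N, Nat.right_le_pair n N, fun l => ?_⟩
    rw [dist_comm, dist_eq_norm] at hn
    simpa [q] using (norm_le_pi_norm _ l).trans_lt hn
  obtain ⟨s, hs⟩ := exists_seq_of_forall_lt_exists (α := X × (X →L[ℝ] ℝ) × Set.Ioi (0 : ℝ))
    (fun n f y => y.2.1 y.1 = 1 ∧ (∀ m h, y.2.1 (f m h).1 = 0) ∧
      (∀ i l, i ≤ n → y.2.1 (q i l) = 0) ∧ ‖y.1‖ ≤ (1 / 2) ^ n ∧
      ∀ m h, (y.2.2 : ℝ) * (∑ l, ‖q n l‖ + ‖y.1‖) * (‖(f m h).2.1‖ + 1) ≤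
        (f m h).2.2 * ((1 / 2) ^ m * (1 / 2) ^ n)) (by
    intro n f
    let A : Set X := (Set.range fun m : Fin n => (f m m.2).1) ∪
      Set.range fun il : Fin (n + 1) × Fin d => q il.1 il.2
    have hA : A.Finite := (Set.finite_range _).union (Set.finite_range _)
    have := FiniteDimensional.span_of_finite ℝ hA
    obtain ⟨x, hx, hxn⟩ := exists_small_notMem hX (span ℝ A)
      (r := (1 / 2) ^ n) (by positivity)
    obtain ⟨φ, hφ1, hφ⟩ := exists_dual_eq_one_of_notMem hx
    -- Only finitely many earlier indices constrain the new coefficient, and every small positive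
    -- number satisfies them.
    have hev : ∀ᶠ c : ℝ in 𝓝[>] 0, ∀ m : Fin n,
        c * (∑ l, ‖q n l‖ + ‖x‖) * (‖(f m m.2).2.1‖ + 1) ≤
          (f m m.2).2.2 * ((1 / 2) ^ (m : ℕ) * (1 / 2) ^ n) := by
      rw [eventually_all]
      intro m
      have hpos : (0 : ℝ) < (f m m.2).2.2 * ((1 / 2) ^ (m : ℕ) * (1 / 2) ^ n) :=
        mul_pos (f m m.2).2.2.2 (by positivity)
      have hc : Tendsto (fun c : ℝ => c * (∑ l, ‖q n l‖ + ‖x‖) * (‖(f m m.2).2.1‖ + 1))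
          (𝓝[>] 0) (𝓝 0) := by
        have : Continuous fun c : ℝ => c * (∑ l, ‖q n l‖ + ‖x‖) * (‖(f m m.2).2.1‖ + 1) := by
          fun_prop
        simpa using (this.tendsto 0).mono_left nhdsWithin_le_nhds
      exact (hc.eventually (gt_mem_nhds hpos)).mono fun c hc => hc.le
    obtain ⟨c, hc, hc0⟩ := (hev.and self_mem_nhdsWithin).exists
    refine ⟨(x, φ, ⟨c, hc0⟩), hφ1, fun m h => hφ _ (subset_span (Or.inl ⟨⟨m, h⟩, rfl⟩)),
      fun i l h => hφ _ (subset_span (Or.inr ⟨(⟨i, by omega⟩, l), rfl⟩)), hxn,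
      fun m h => hc ⟨m, h⟩⟩)
  exact ⟨{
    q := q
    p := p
    g := fun k => (s k).1
    φ := fun k => (s k).2.1
    γ := fun k => (s k).2.2
    p_le := fun k => max_le_iff.1 (hp k)
    p_freq := hpf
    q_dense := hq
    φ_g_self := fun k => (hs k).1
    φ_g := fun k i h => (hs k).2.1 i h
    φ_q := fun k i l h => (hs k).2.2.1 i l h
    g_norm := fun k => (hs k).2.2.2.1
    γ_pos := fun k => (s k).2.2.2
    γ_le := fun i k h => (hs k).2.2.2.2 i h }⟩

end Existence

/-! ### Nullity on all spaces of dimension greater than `d` -/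

section NullOnPlanes

lemma exists_apply_ne_zero₂ {E : Type*} [AddCommGroup E] [Module ℝ E] {f g : E →ₗ[ℝ] ℝ}
    (hf : f ≠ 0) (hg : g ≠ 0) : ∃ u, f u ≠ 0 ∧ g u ≠ 0 := by
  obtain ⟨x, hx⟩ : ∃ x, f x ≠ 0 := by
    by_contra! h
    exact hf (LinearMap.ext h)
  obtain ⟨y, hy⟩ : ∃ y, g y ≠ 0 := by
    by_contra! h
    exact hg (LinearMap.ext h)
  by_cases hgx : g x = 0
  · by_cases hfy : f y = 0
    · exact ⟨x + y, by simpa [hfy], by simpa [hgx]⟩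
    · exact ⟨y, hfy, hy⟩
  · exact ⟨x, hx, hgx⟩

/-- On each line in a direction `u` with `f u` and `g u` nonzero, the equation is quadratic with
leading coefficient `f u * g u`, so it has finitely many solutions; Fubini finishes. -/
lemma ae_mul_ne_of_ne_zero {E : Type*} [NormedAddCommGroup E] [NormedSpace ℝ E]
    [FiniteDimensional ℝ E] [MeasurableSpace E] [BorelSpace E] (μ : Measure E)
    [μ.IsAddHaarMeasure] {f g : E →ₗ[ℝ] ℝ} (hf : f ≠ 0) (hg : g ≠ 0) (h : E →ₗ[ℝ] ℝ)
    (a b c : ℝ) : ∀ᵐ w ∂μ, (f w + a) * (g w + b) ≠ h w + c := by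
  obtain ⟨u, hfu, hgu⟩ := exists_apply_ne_zero₂ hf hg
  have cf := f.continuous_of_finiteDimensional
  have cg := g.continuous_of_finiteDimensional
  have ch := h.continuous_of_finiteDimensional
  have hclosed : IsClosed {w | (f w + a) * (g w + b) = h w + c} :=
    isClosed_eq (by fun_prop) (by fun_prop)
  refine ae_mem_of_ae_add_linearMap_mem (𝕜 := ℝ) (LinearMap.toSpanSingleton ℝ E u) volume μ
    (s := {w | (f w + a) * (g w + b) ≠ h w + c}) hclosed.measurableSet.compl fun y => ?_
  open Polynomial in
  set P : ℝ[X] := (C (f y + a) + C (f u) * X) * (C (g y + b) + C (g u) * X) -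
    (C (h y + c) + C (h u) * X) with hP
  have hP0 : P ≠ 0 := by
    intro h0
    have : P.coeff 2 = f u * g u := by
      have : P = Polynomial.C (f u * g u) * Polynomial.X ^ 2 +
          Polynomial.C ((f y + a) * g u + f u * (g y + b) - h u) * Polynomial.X +
          Polynomial.C ((f y + a) * (g y + b) - (h y + c)) := by
        rw [hP]
        simp only [map_add, map_sub, map_mul]
        ring
      rw [this, Polynomial.coeff_add, Polynomial.coeff_add, Polynomial.coeff_C_mul_X_pow,
        Polynomial.coeff_C_mul_X, Polynomial.coeff_C]
      simp
    rw [h0] at this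
    simp at this
    tauto
  have hfin := (Polynomial.finite_setOfPred_isRoot hP0).measure_zero (volume : Measure ℝ)
  rw [← compl_compl {x | P.IsRoot x}] at hfin
  filter_upwards [mem_ae_iff.2 hfin] with x hx hroot
  refine hx ?_
  simp only [Set.mem_ofPred_eq, Polynomial.IsRoot.def, hP]
  simp only [map_add, LinearMap.toSpanSingleton_apply, map_smul, smul_eq_mul] at hroot
  simp only [Polynomial.eval_sub, Polynomial.eval_mul, Polynomial.eval_add, Polynomial.eval_C,
    Polynomial.eval_X]
  linarith

/-- The restrictions of affine functions form a finite-dimensional, hence closed, subspace of `ι →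
ℝ` with pointwise convergence; the coefficients themselves need not converge. -/
lemma exists_affine_of_tendsto {E ι : Type*} [AddCommGroup E] [Module ℝ E]
    [FiniteDimensional ℝ E] (e : ι → E) (F : ℕ → E →ₗ[ℝ] ℝ) (c : ℕ → ℝ) {G : ι → ℝ}
    (h : ∀ i, Tendsto (fun n => F n (e i) + c n) atTop (𝓝 (G i))) :
    ∃ (f : E →ₗ[ℝ] ℝ) (a : ℝ), ∀ i, G i = f (e i) + a := by
  let T : (E →ₗ[ℝ] ℝ) × ℝ →ₗ[ℝ] (ι → ℝ) :=
    { toFun := fun p i => p.1 (e i) + p.2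
      map_add' := fun p p' => by ext i; simp; ring
      map_smul' := fun r p => by ext i; simp; ring }
  have hc : IsClosed (LinearMap.range T : Set (ι → ℝ)) :=
    (LinearMap.range T).closed_of_finiteDimensional
  have : G ∈ LinearMap.range T := hc.mem_of_tendsto (tendsto_pi_nhds.2 h)
    (Eventually.of_forall fun n => ⟨(F n, c n), rfl⟩)
  obtain ⟨⟨f, a⟩, hfa⟩ := this
  exact ⟨f, a, fun i => (congrFun hfa i).symm⟩

variable {X : Type*} [NormedAddCommGroup X] [NormedSpace ℝ X] [CompleteSpace X] {d : ℕ}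

lemma BlockData.mono_eq_affine (D : BlockData X d) (W : Submodule ℝ X) [FiniteDimensional ℝ W]
    (a : X) {E : Set W} {t : W → ℕ → Fin d → ℝ}
    (ht : ∀ w ∈ E, t w ∈ cube d ∧ D.param (t w) = w + a) (ab : (ℕ × Fin d) × (ℕ × Fin d)) :
    ∃ (f : W →ₗ[ℝ] ℝ) (c : ℝ), ∀ w ∈ E, mono ab (t w) = f w + c := by
  choose k hk hpk using D.p_freq ab
  obtain ⟨f, c, h⟩ := exists_affine_of_tendsto (fun w : E => (w : W))
    (fun n => (D.γ (k n))⁻¹ • ((D.φ (k n) : X →ₗ[ℝ] ℝ) ∘ₗ W.subtype))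
    (fun n => (D.γ (k n))⁻¹ * D.φ (k n) a) (G := fun w => mono ab (t w)) (by
      intro w
      rw [tendsto_iff_norm_sub_tendsto_zero]
      refine squeeze_zero (fun _ => norm_nonneg _) (g := fun n => (1 / 2 : ℝ) ^ n * 2) ?_ (by
        simpa using (tendsto_pow_atTop_nhds_zero_of_lt_one (r := (1 / 2 : ℝ)) (by norm_num)
          (by norm_num)).mul_const 2)
      intro n
      obtain ⟨h1, h2⟩ := ht w w.2
      have h3 := D.abs_φ_param_sub_le (k n) h1
      have hγ := D.γ_pos (k n)
      rw [h2, hpk n, map_add] at h3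
      have h4 : ((D.γ (k n))⁻¹ • ((D.φ (k n) : X →ₗ[ℝ] ℝ) ∘ₗ W.subtype)) (w : W) +
          (D.γ (k n))⁻¹ * D.φ (k n) a - mono ab (t w) =
          (D.γ (k n))⁻¹ * (D.φ (k n) ((w : W) : X) + D.φ (k n) a - D.γ (k n) * mono ab (t w)) := by
        simp
        field_simp
      rw [h4, norm_mul, Real.norm_eq_abs, Real.norm_eq_abs, abs_of_pos (inv_pos.2 hγ)]
      calc (D.γ (k n))⁻¹ * |D.φ (k n) ((w : W) : X) + D.φ (k n) a - D.γ (k n) * mono ab (t w)|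
          ≤ (D.γ (k n))⁻¹ * (D.γ (k n) * (1 / 2) ^ (k n) * 2) := by gcongr
        _ = (1 / 2) ^ (k n) * 2 := by field_simp
        _ ≤ (1 / 2) ^ n * 2 := by
          gcongr ?_ * 2
          exact pow_le_pow_of_le_one (by norm_num) (by norm_num) (hk n))
  exact ⟨f, c, fun w hw => h ⟨w, hw⟩⟩

variable [MeasurableSpace X] [BorelSpace X]

lemma BlockData.image_mem_classA (D : BlockData X d) (W : Submodule ℝ X) [FiniteDimensional ℝ W]
    (hW : d < Module.finrank ℝ W) : D.param '' cube d ∈ classA W := by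
  rw [mem_classA_iff]
  refine ⟨(isCompact_cube.image_of_continuousOn D.continuousOn_param).measurableSet, fun a => ?_⟩
  by_contra hE
  set E : Set W := {w | (w : X) + a ∈ D.param '' cube d}
  have hE' : ∀ p : W → Prop, (∀ᵐ w ∂Measure.addHaar, p w) → ∃ w ∈ E, p w := by
    intro p hp
    by_contra! h
    exact hE (hp.mono fun w hw hwE => h w hwE hw)
  have hex : ∀ w : W, w ∈ E → ∃ t, t ∈ cube d ∧ D.param t = w + a := fun w hw => hw
  choose! t ht using hex
  choose f c hf using D.mono_eq_affine W a ht
  -- A diagonal pair of indices encodes a single coordinate in `mono`.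
  have hcoord : ∀ i l, ∀ w ∈ E, t w i l = f ((i, l), (i, l)) w + c ((i, l), (i, l)) := by
    intro i l w hw
    simpa [mono] using hf ((i, l), (i, l)) w hw
  have hzero : ∀ i l i' l', i ≠ i' → f ((i, l), (i, l)) ≠ 0 → f ((i', l'), (i', l')) = 0 := by
    intro i l i' l' hii h0
    by_contra h0'
    obtain ⟨w, hw, hne⟩ := hE' _ (ae_mul_ne_of_ne_zero Measure.addHaar h0 h0'
      (f ((i, l), (i', l'))) (c ((i, l), (i, l))) (c ((i', l'), (i', l'))) (c ((i, l), (i', l'))))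
    refine hne ?_
    rw [← hf ((i, l), (i', l')) w hw, ← hcoord i l w hw, ← hcoord i' l' w hw]
    simp [mono, hii]
  obtain ⟨i₀, hi₀⟩ : ∃ i₀, ∀ i ≠ i₀, ∀ l, f ((i, l), (i, l)) = 0 := by
    by_cases h : ∃ i l, f ((i, l), (i, l)) ≠ 0
    · obtain ⟨i, l, h⟩ := h
      exact ⟨i, fun i' hi' l' => hzero i l i' l' hi'.symm h⟩
    · push Not at h
      exact ⟨0, fun i _ l => h i l⟩
  obtain ⟨w₀, hw₀, -⟩ := hE' (fun _ => True) (by simp)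
  have hup : ∀ w ∈ E, t w = Function.update (t w₀) i₀ (t w i₀) := by
    intro w hw
    ext i l
    by_cases hi : i = i₀
    · subst hi; simp
    · simp [hi, hcoord i l w hw, hcoord i l w₀ hw₀, hi₀ i hi l]
  let U : Submodule ℝ X := span ℝ (Set.range (D.dir (t w₀) i₀))
  have hmem : ∀ w ∈ E, ((w : X) - D.param (Function.update (t w₀) i₀ 0) + a) ∈ U := by
    intro w hw
    have h1 := D.param_update (ht w₀ hw₀).1 i₀ ((ht w hw).1 i₀ trivial)
    rw [← hup w hw, (ht w hw).2] at h1
    have : (w : X) - D.param (Function.update (t w₀) i₀ 0) + a =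
        ∑ l, t w i₀ l • D.dir (t w₀) i₀ l := by
      rw [sub_add_eq_add_sub, h1]; abel
    rw [this]
    exact (mem_span_range_iff_exists_fun ℝ).2 ⟨_, rfl⟩
  -- The `d` directions of the only varying block cannot span `W`, so `E` lies in a translate of a
  -- proper subspace.
  have hU : U.comap W.subtype ≠ ⊤ := by
    intro h
    rw [comap_subtype_eq_top] at h
    have := FiniteDimensional.span_of_finite ℝ (Set.finite_range (D.dir (t w₀) i₀))
    have h1 : Module.finrank ℝ W ≤ Module.finrank ℝ U := Submodule.finrank_mono h
    have h2 : Module.finrank ℝ U ≤ Fintype.card (Fin d) := finrank_range_le_card _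
    rw [Fintype.card_fin] at h2
    omega
  have hnull := Measure.addHaar_submodule (Measure.addHaar : Measure W) _ hU
  have hae : ∀ᵐ w : W ∂Measure.addHaar, w + -w₀ ∉ U.comap W.subtype := by
    rw [ae_iff]
    simp only [not_not]
    exact (measure_preimage_add_right (Measure.addHaar : Measure W) (-w₀) _).trans hnull
  obtain ⟨w, hw, hwU⟩ := hE' _ hae
  refine hwU ?_
  have := U.sub_mem (hmem w hw) (hmem w₀ hw₀)
  simpa [sub_eq_add_neg] using this

end NullOnPlanes

/-! ### The image is not in `classCStar X d` -/

section NotInClassC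

open scoped Pointwise

/-- Resampling one coordinate independently preserves the product measure; Fubini then integrates
the null slices. -/
lemma infinitePi_eq_zero_of_update {ι : Type*} {Y : ι → Type*} [DecidableEq ι]
    [∀ i, MeasurableSpace (Y i)] (μ : ∀ i, Measure (Y i)) [∀ i, IsProbabilityMeasure (μ i)]
    (i : ι) {T : Set (∀ i, Y i)} (hT : MeasurableSet T)
    (h : ∀ t, μ i {s | Function.update t i s ∈ T} = 0) : Measure.infinitePi μ T = 0 := by
  let u : (∀ i, Y i) × Y i → ∀ i, Y i := fun x => Function.update x.1 i x.2
  have hu : Measurable u := by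
    rw [measurable_pi_iff]
    intro j
    by_cases hj : j = i
    · subst hj
      simpa [u] using measurable_snd
    · simp only [u, Function.update_of_ne hj]
      exact (measurable_pi_apply j).comp measurable_fst
  have hmap : ((Measure.infinitePi μ).prod (μ i)).map u = Measure.infinitePi μ := by
    refine Measure.eq_infinitePi μ fun s B hB => ?_
    rw [Measure.map_apply hu (MeasurableSet.pi s.countable_toSet fun j _ => hB j)]
    have hpre : u ⁻¹' (Set.pi s B) =
        (Set.pi (s.erase i : Finset ι) B) ×ˢ (if i ∈ s then B i else Set.univ) := by
      ext ⟨t, x⟩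
      simp only [u, Set.mem_preimage, Set.mem_pi, Set.mem_prod, Finset.mem_coe, Finset.mem_erase]
      constructor
      · intro hx
        refine ⟨fun j hj => by simpa [hj.1] using hx j hj.2, ?_⟩
        split_ifs with hi
        · simpa using hx i hi
        · trivial
      · rintro ⟨h1, h2⟩ j hj
        by_cases hji : j = i
        · subst hji
          simpa [hj] using h2
        · simpa [hji] using h1 j ⟨hji, hj⟩
    rw [hpre, Measure.prod_prod, Measure.infinitePi_pi μ fun j _ => hB j]
    split_ifs with hi
    · exact Finset.prod_erase_mul _ _ hi
    · rw [measure_univ, mul_one, Finset.erase_eq_of_notMem hi]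
  rw [← hmap, Measure.map_apply hu hT, Measure.prod_apply (hu hT)]
  simp only [lintegral_eq_zero_iff' (measurable_measure_prodMk_left (hu hT)).aemeasurable]
  exact Eventually.of_forall h

/-- The uniform distribution on the cube. -/
def cubeMeasure (d : ℕ) : Measure (ℕ → Fin d → ℝ) :=
  Measure.infinitePi fun _ => (volume : Measure (Fin d → ℝ)).restrict (Set.Icc 0 1)

instance isProbabilityMeasure_restrict_Icc (d : ℕ) :
    IsProbabilityMeasure ((volume : Measure (Fin d → ℝ)).restrict (Set.Icc 0 1)) :=
  ⟨by simp [Real.volume_Icc_pi]⟩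

lemma cubeMeasure_cube (d : ℕ) : cubeMeasure d (cube d) = 1 := by
  unfold cubeMeasure cube
  rw [Measure.infinitePi_pi_univ _ fun _ => measurableSet_Icc]
  simp [Real.volume_Icc_pi]

variable {X : Type*} [NormedAddCommGroup X] [NormedSpace ℝ X] [CompleteSpace X]
  [MeasurableSpace X] [BorelSpace X] {d : ℕ}

lemma BlockData.cubeMeasure_eq_zero (D : BlockData X d) {V : Submodule ℝ X}
    [FiniteDimensional ℝ V] (hV : Module.finrank ℝ V = d) {ε : ℝ} (hε : 0 < ε) {S : Set X}
    (hS : S ∈ classAStarEps V ε) : cubeMeasure d (cube d ∩ D.param ⁻¹' S) = 0 := by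
  have hcube : MeasurableSet (cube d) := isCompact_cube.measurableSet
  have hT : MeasurableSet (cube d ∩ D.param ⁻¹' S) := by
    have h1 := (continuousOn_iff_continuous_domRestrict.1 D.continuousOn_param).measurable hS.1
    have h2 := hcube.subtype_image h1
    convert! h2
    ext t
    simp [and_comm]
  obtain ⟨v, hv, hspan⟩ := exists_family_span_eq hV
  obtain ⟨η, hη, hη'⟩ := exists_gap_lt_of_close hv hε
  -- For `i ≥ N` the error `5 * (1/2)^i` of the direction is below `η/2`; the other half of `η` is
  -- left for `q i`.
  obtain ⟨N, hN⟩ := exists_pow_lt_of_lt_one (show 0 < η / 10 by positivity)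
    (show (1 / 2 : ℝ) < 1 by norm_num)
  obtain ⟨i, hi, hq⟩ := D.q_dense v (η / 2) (by positivity) N
  refine infinitePi_eq_zero_of_update _ i hT fun t => ?_
  rcases Set.eq_empty_or_nonempty {s | Function.update t i s ∈ cube d ∩ D.param ⁻¹' S} with h | h
  · rw [h, measure_empty]
  -- `t` may lie outside the cube; a point of the slice gives `t'` inside the cube with the same
  -- slice in block `i`.
  obtain ⟨s₀, hs₀, -⟩ := h
  set t' := Function.update t i s₀ with ht'
  have hγ := D.γ_pos i
  have hclose : ∀ l, ‖(D.γ i)⁻¹ • D.dir t' i l - v l‖ < η := by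
    intro l
    have h1 : ‖(D.γ i)⁻¹ • D.dir t' i l - D.q i l‖ ≤ (1 / 2) ^ i * 5 := by
      have h2 : (D.γ i)⁻¹ • D.dir t' i l - D.q i l =
          (D.γ i)⁻¹ • (D.dir t' i l - D.γ i • D.q i l) := by
        rw [smul_sub, smul_smul, inv_mul_cancel₀ hγ.ne', one_smul]
      rw [h2, norm_smul, Real.norm_eq_abs, abs_of_pos (inv_pos.2 hγ)]
      calc (D.γ i)⁻¹ * ‖D.dir t' i l - D.γ i • D.q i l‖
          ≤ (D.γ i)⁻¹ * (D.γ i * (1 / 2) ^ i * 5) := by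
            gcongr
            exact D.norm_dir_sub_le hs₀ i l
        _ = (1 / 2) ^ i * 5 := by field_simp
    have h3 : (1 / 2 : ℝ) ^ i ≤ (1 / 2) ^ N :=
      pow_le_pow_of_le_one (by norm_num) (by norm_num) hi
    have h4 := norm_add_le ((D.γ i)⁻¹ • D.dir t' i l - D.q i l) (D.q i l - v l)
    rw [sub_add_sub_cancel] at h4
    linarith [hq l]
  have hgap := (hη' _ hclose).2
  have hrange : (Set.range fun l => (D.γ i)⁻¹ • D.dir t' i l) =
      (D.γ i)⁻¹ • Set.range (D.dir t' i) := by
    rw [Set.smul_set_range]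
  rw [hspan, hrange, span_smul_eq_of_isUnit _ _ (IsUnit.mk0 _ (inv_ne_zero hγ.ne'))] at hgap
  have := FiniteDimensional.span_of_finite ℝ (Set.finite_range (D.dir t' i))
  have hA := hS.2 _ hgap
  have hae := classA_ae_linearMap (volume : Measure (Fin d → ℝ)) hA
    (Fintype.linearCombination ℝ (D.dir t' i)) (Fintype.range_linearCombination ℝ _)
    (D.param (Function.update t' i 0))
  have hae' := ae_restrict_of_ae (s := Set.Icc (0 : Fin d → ℝ) 1) hae
  rw [ae_iff] at hae'
  refine measure_mono_null ?_ hae'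
  rintro s ⟨hs, hsS⟩
  have hs01 : s ∈ Set.Icc (0 : Fin d → ℝ) 1 := by simpa using hs i trivial
  have hup : Function.update t i s = Function.update t' i s := by simp [ht']
  rw [Set.mem_preimage, hup, D.param_update hs₀ i hs01] at hsS
  simpa [Fintype.linearCombination_apply, add_comm] using hsS

lemma BlockData.image_notMem_classCStar (D : BlockData X d) :
    D.param '' cube d ∉ classCStar X d := by
  intro hK
  obtain ⟨S, V, ε, h, hKS⟩ := mem_classCStar_iff.1 hK
  have h0 : cubeMeasure d (⋃ k, cube d ∩ D.param ⁻¹' S k) = 0 := by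
    rw [measure_iUnion_null_iff]
    intro k
    obtain ⟨h1, h2, h3, -, h5⟩ := h k
    exact D.cubeMeasure_eq_zero h2 h3 h5
  have hsub : cube d ⊆ ⋃ k, cube d ∩ D.param ⁻¹' S k := by
    intro t ht
    have : D.param t ∈ ⋃ k, S k := hKS ▸ Set.mem_image_of_mem _ ht
    simpa [ht] using this
  have := measure_mono_null hsub h0
  rw [cubeMeasure_cube] at this
  exact one_ne_zero this

end NotInClassC

/-! ### Assembling the separation -/

section Main

variable {X : Type*} [NormedAddCommGroup X] [NormedSpace ℝ X] [CompleteSpace X]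
  [MeasurableSpace X] [BorelSpace X]

lemma BlockData.image_mem_classCStar {d : ℕ} (D : BlockData X d)
    (hX : ¬ FiniteDimensional ℝ X) : D.param '' cube d ∈ classCStar X (d + 1) := by
  obtain ⟨v, hv⟩ := exists_linearIndependent_fin hX (d + 1)
  have hfd := FiniteDimensional.span_of_finite ℝ (Set.finite_range v)
  have hdim : Module.finrank ℝ (span ℝ (Set.range v)) = d + 1 := by
    simpa using finrank_span_eq_card hv
  obtain ⟨ε, h0, h1, h⟩ := le_finrank_of_gap_lt (V := span ℝ (Set.range v))
  refine mem_classCStar_iff.2 ⟨fun _ => D.param '' cube d, fun _ => span ℝ (Set.range v),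
    fun _ => ε, fun _ => ⟨hfd, hdim, h0, h1,
      (isCompact_cube.image_of_continuousOn D.continuousOn_param).measurableSet,
      fun W _ hW => D.image_mem_classA W ?_⟩, (Set.iUnion_const _).symm⟩
  have := h W hW
  omega

lemma exists_isCompact_mem_classCStar_succ_notMem [TopologicalSpace.SeparableSpace X]
    (hX : ¬ FiniteDimensional ℝ X) {d : ℕ} (hd : 1 ≤ d) :
    ∃ K : Set X, IsCompact K ∧ K ∈ classCStar X (d + 1) ∧ K ∉ classCStar X d := by
  obtain ⟨D⟩ := exists_blockData hX hd
  exact ⟨D.param '' cube d, isCompact_cube.image_of_continuousOn D.continuousOn_param,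
    D.image_mem_classCStar hX, D.image_notMem_classCStar⟩

end Main

end NullSets

end

theorem mainTheorem4 {X : Type*} [NormedAddCommGroup X] [NormedSpace ℝ X] [CompleteSpace X]
    [TopologicalSpace.SeparableSpace X] [MeasurableSpace X] [BorelSpace X]
    (hX : ¬ FiniteDimensional ℝ X) :
    (∀ d : ℕ, 1 ≤ d →
      NullSets.classCStar X d ⊂ NullSets.classCStar X (d + 1) ∧
      NullSets.classCStar X d ⊂ NullSets.aronszajnNull X ∧
      ∃ K : Set X, IsCompact K ∧
        K ∈ NullSets.classCStar X (d + 1) ∧ K ∉ NullSets.classCStar X d) ∧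
    (⋃ d : ℕ, ⋃ _ : 1 ≤ d, NullSets.classCStar X d) ⊂ NullSets.aronszajnNull X := by
  have : SecondCountableTopology X := UniformSpace.secondCountable_of_separable X
  have hK := fun (d : ℕ) (hd : 1 ≤ d) =>
    NullSets.exists_isCompact_mem_classCStar_succ_notMem hX hd
  refine ⟨fun d hd => ?_, ?_⟩
  · obtain ⟨K, hKc, hK1, hK2⟩ := hK d hd
    exact ⟨⟨NullSets.classCStar_subset_succ hX d, fun h => hK2 (h hK1)⟩,
      ⟨NullSets.classCStar_subset_aronszajnNull d,
        fun h => hK2 (h (NullSets.classCStar_subset_aronszajnNull (d + 1) hK1))⟩,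
      K, hKc, hK1, hK2⟩
  · refine ⟨Set.iUnion₂_subset fun d _ => NullSets.classCStar_subset_aronszajnNull d, fun h => ?_⟩
    -- The union of the separating compact sets is Aronszajn null, and it escapes every class
    -- because the classes are closed under Borel subsets.
    choose K hKc hK1 hK2 using fun d : ℕ => hK (d + 1) (Nat.le_add_left 1 d)
    have hA : (⋃ d, K d) ∈ NullSets.aronszajnNull X := NullSets.aronszajnNull_iUnion fun d =>
      NullSets.classCStar_subset_aronszajnNull _ (hK1 d)
    obtain ⟨d, hd, hmem⟩ := Set.mem_iUnion₂.1 (h hA)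
    obtain ⟨m, rfl⟩ : ∃ m, d = m + 1 := ⟨d - 1, by omega⟩
    exact hK2 m (NullSets.classCStar_subset hmem (hKc m).measurableSet
      (Set.subset_iUnion K m))
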